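/- Fix integers $b_s\ge 2$, $L\ge 0$ and $d\ge 2$. For $r=((r)_1,\dots,(r)_{d-1})\in\mathbb{Z}_{\ge 0}^{d-1}$ let $\mathrm{TT}_r$ denote the set of real $n\times\dots\times n$ tensors of order $d$ that can be written in tensor-train form $T(i_1,\dots,i_d)=G_1(i_1)G_2(i_2)\cdots G_d(i_d)$ with real matrices $G_j(i)$ of size $(r)_{j-1}\times (r)_j$, where $(r)_0=(r)_d=1$ (for $d=2$: the $n\times n$ matrices of rank at most $r$; if some $(r)_j=0$, only the zero tensor). For $0\le k\le L$ and $T_k\in\mathbb{R}^{b_s^k\times\dots\times b_s^k}$, let $\mathrm{ext}_{L-k}(T_k)\in\mathbb{R}^{b_s^L\times\dots\times b_s^L}$ be obtained by replacing each entry of $T_k$ by a block with side lengths $b_s^{L-k}$ all of whose entries equal the replaced entry. For $\mathbf r=(r_0,\dots,r_L)$ with $r_k\in\mathbb{Z}_{\ge0}^{d-1}$, the multiresolution tensor-train format is $$\mathrm{MS}_{\mathrm{TT}_{\mathbf r}}=\Bigl\{\sum_{k=0}^L \mathrm{ext}_{L-k}(T_k)\;:\; T_k\in\mathbb{R}^{b_s^k\times\dots\times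 b_s^k},\ T_k\in \mathrm{TT}_{r_k}\Bigr\}\subseteq \mathbb{R}^{b_s^L\times\dots\times b_s^L}.$$ 1. For $d=2$ (so each $r_k$ is a nonnegative integer), $\mathrm{MS}_{\mathrm{TT}_{\mathbf r}}$ is closed if and only if, for some $k\in\{0,\dots,L\}$, $\mathbf r$ has the form $(r_0,\dots,r_{k-1},r_k,0,\dots,0)$ with $r_k\ge b_s^k$ (for $b_s^k\times b_s^k$ matrices such a rank bound is the same as the bound $r_k=b_s^k$), or the form $(0,\dots,0,r_k,0,\dots,0)$ with $r_k\ge 0$. 2. Let $d\ge 3$, and suppose that each $r_i$ is either the zero vector or a vector of positive integers. If, for some $k\in\{0,\dots,L\}$, $\mathbf r=(r_0,\dots,r_k,0,\dots,0)$ with $r_k\neq 0$ and $(r_k)_1<b_s^k$, and $(r_i)_1\ne 0$ for some $i<k$, then $\mathrm{MS}_{\mathrm{TT}_{\mathbf r}}$ is not closed. -/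

import Mathlib

/-- Real tensors of order `d` with all side lengths equal to `n`. Indices start at `0`. The topology
is the entrywise one, i.e. that of the Frobenius norm. -/
abbrev Tensor (d n : ℕ) : Type := (Fin d → Fin n) → ℝ

/-- The bond dimensions `(1, r₁, …, r_{d-1}, 1)` of a tensor train with rank vector
`r = (r₁, …, r_{d-1})`; the entry `r_{j+1}` of the rank vector is `r j`. -/
def ttBond {d : ℕ} (r : Fin (d - 1) → ℕ) (j : Fin (d + 1)) : ℕ :=
  if h : 0 < j.val ∧ j.val < d then r ⟨j.val - 1, by omega⟩ else 1

/-- Tensors that have a tensor-train representation with rank vector `r`: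
`T(i₁, …, i_d) = ∑_{α₀, …, α_d} G₁(i₁)(α₀, α₁) ⋯ G_d(i_d)(α_{d-1}, α_d)`
with cores `G_j(i)` of size `r_{j-1} × r_j`, where `r₀ = r_d = 1`.
(Cores can be padded by zeros, so this is the set of tensors of tensor-train rank at most `r`.) -/
def TT (d n : ℕ) (r : Fin (d - 1) → ℕ) : Set (Tensor d n) :=
  {T | ∃ G : (j : Fin d) → Fin n →
        Matrix (Fin (ttBond r j.castSucc)) (Fin (ttBond r j.succ)) ℝ,
      ∀ i : Fin d → Fin n,
        T i = ∑ α : ((j : Fin (d + 1)) → Fin (ttBond r j)),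
          ∏ j : Fin d, G j (i j) (α j.castSucc) (α j.succ)}

theorem coarse_index_lt {b k m : ℕ} (h : k ≤ m) (x : Fin (b ^ m)) :
    x.val / b ^ (m - k) < b ^ k := by
  apply Nat.div_lt_of_lt_mul
  rw [← pow_add, Nat.sub_add_cancel h]
  exact x.isLt

/-- The block extension `ext_{m-k}` from the grid of side `b ^ k` to the grid of side `b ^ m`: each
entry is replaced by a block of side `b ^ (m - k)` with constant entries. -/
def blockExt {d b k m : ℕ} (h : k ≤ m) (T : Tensor d (b ^ k)) : Tensor d (b ^ m) :=
  fun i => T fun j => ⟨(i j).val / b ^ (m - k), coarse_index_lt h (i j)⟩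

/-- The multiresolution tensor-train format with batch size `b`, levels `0, …, L`, and rank vectors
`r 0, …, r L`: all sums of block extensions `∑ₖ ext_{L-k}(Sₖ)` with `Sₖ` of side `b ^ k` and of
tensor-train rank at most `r k`. -/
def MSTT (b L d : ℕ) (r : Fin (L + 1) → Fin (d - 1) → ℕ) : Set (Tensor d (b ^ L)) :=
  {T | ∃ S : (k : Fin (L + 1)) → Tensor d (b ^ k.val),
      (∀ k, S k ∈ TT d (b ^ k.val) (r k)) ∧
      T = ∑ k : Fin (L + 1), blockExt k.is_le (S k)}

/-! Non-closedness comes from a tangent direction at the all-ones matrix, which is available in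
every nonzero level. Let `1` be the all-ones vector. As t → ∞, (t1 + u)(1 + v/t)ᵀ + N - t11ᵀ tends
to X = 1vᵀ + u1ᵀ + N. If rank N ≤ r_k - 1, the first two terms fit into the top nonzero level k, and
the last fits into a nonzero level i < k.

For X to leave the format, rank (X - E) > r_k must hold for every E constant on b × b blocks, since
all coarser levels together produce such an E. `exists_tangent_matrix` supplies X. It starts from a
diagonal D for which D - E is always invertible; D is a sum 1vᵀ + u1ᵀ plus n - 2 rank-one terms, of
which N keeps r_k - 1. For d ≥ 3, slices and lifts reduce tensors to matrices.

The closed cases for d = 2 are images of closed sets of matrices under the closed embedding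
`blockExt`. -/

namespace Matrix

variable {m n : Type*} [Fintype n]

theorem rank_le_iff_exists_mul {A : Matrix m n ℝ} {s : ℕ} :
    A.rank ≤ s ↔ ∃ (g : Matrix m (Fin s) ℝ) (h : Matrix (Fin s) n ℝ), A = g * h := by
  classical
  constructor
  · intro hA
    obtain ⟨p, hp⟩ : ∃ p : LinearMap.range A.mulVecLin →ₗ[ℝ] (Fin s → ℝ),
        Function.Injective p := by
      apply finrank_le_iff_exists_linearMap.1
      simpa [Matrix.rank] using hA
    obtain ⟨q, hq⟩ := p.exists_leftInverse_of_injective (LinearMap.ker_eq_bot.2 hp)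
    refine ⟨LinearMap.toMatrix' ((LinearMap.range A.mulVecLin).subtype ∘ₗ q),
      LinearMap.toMatrix' (p ∘ₗ A.mulVecLin.rangeRestrict), ?_⟩
    rw [← LinearMap.toMatrix'_comp]
    have : ((LinearMap.range A.mulVecLin).subtype ∘ₗ q) ∘ₗ (p ∘ₗ A.mulVecLin.rangeRestrict)
        = A.mulVecLin := by
      ext1 i
      ext1
      have := LinearMap.congr_fun hq (A.mulVecLin.rangeRestrict (Pi.single i 1))
      simp only [LinearMap.comp_apply, LinearMap.id_apply] at this ⊢
      simp [this]
    rw [this]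
    exact (LinearMap.toMatrix'_toLin' A).symm
  · rintro ⟨g, h, rfl⟩
    exact (rank_mul_le_left _ _).trans (by simpa using rank_le_card_width g)

theorem rank_add_le_add (A B : Matrix m n ℝ) : (A + B).rank ≤ A.rank + B.rank := by
  unfold Matrix.rank
  refine (Submodule.finrank_mono ?_).trans (Submodule.finrank_add_le_finrank_add_finrank _ _)
  rw [mulVecLin_add]
  exact LinearMap.range_add_le _ _

theorem rank_sum_vecMulVec_le {ι : Type*} (I : Finset ι) (x : ι → m → ℝ) (y : ι → n → ℝ) :
    (∑ i ∈ I, vecMulVec (x i) (y i)).rank ≤ I.card := by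
  classical
  induction I using Finset.induction_on with
  | empty => simp
  | insert a s ha ih =>
    rw [Finset.sum_insert ha, Finset.card_insert_of_notMem ha]
    have := rank_add_le_add (vecMulVec (x a) (y a)) (∑ i ∈ s, vecMulVec (x i) (y i))
    have := rank_vecMulVec_le (x a) (y a)
    omega

/-- Rank is lower semicontinuous: the operators of rank at least `s + 1` form an open set. -/
theorem isClosed_setOf_rank_le [Fintype m] (s : ℕ) : IsClosed {A : Matrix m n ℝ | A.rank ≤ s} := by
  classical
  rw [← isOpen_compl_iff]
  let φ : Matrix m n ℝ →ₗ[ℝ] ((n → ℝ) →L[ℝ] (m → ℝ)) :=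
    LinearMap.toContinuousLinearMap.toLinearMap ∘ₗ (Matrix.toLin' (R := ℝ)).toLinearMap
  have hφ : Continuous φ := LinearMap.continuous_of_finiteDimensional φ
  convert (isOpen_setOfPred_nat_le_rank (𝕜 := ℝ) (E := n → ℝ) (F := m → ℝ) (s + 1)).preimage hφ using 1
  ext A
  have : (φ A : (n → ℝ) →ₗ[ℝ] (m → ℝ)) = A.mulVecLin := by ext; simp [φ]
  simp only [Set.mem_compl_iff, Set.mem_ofPred_eq, not_le, Set.mem_preimage, this]
  rw [Matrix.rank, LinearMap.rank, ← Module.finrank_eq_rank, Nat.cast_le]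
  rfl

end Matrix

/-! ### Matrices far from block-constant ones -/

/-- The diagonal weights `1 - b, 1, …, 1`, repeated with period `b`. -/
def blockWeight (b x : ℕ) : ℝ := if x % b = 0 then 1 - b else 1

theorem blockWeight_ne_zero {b : ℕ} (hb : 2 ≤ b) (x : ℕ) : blockWeight b x ≠ 0 := by
  unfold blockWeight
  have : (2 : ℝ) ≤ b := by exact_mod_cast hb
  split_ifs
  · linarith
  · norm_num

theorem sum_mul_blockWeight {b : ℕ} (hb : 2 ≤ b) (f : ℕ → ℝ) (m : ℕ) :
    ∑ z ∈ Finset.range (m * b), f (z / b) * blockWeight b z = 0 := by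
  induction m with
  | zero => simp
  | succ m ih =>
    rw [Nat.succ_mul, Finset.sum_range_add, ih, zero_add]
    have h1 : ∀ j ∈ Finset.range b, f ((m * b + j) / b) * blockWeight b (m * b + j)
        = f m * blockWeight b j := by
      intro j hj
      rw [Finset.mem_range] at hj
      have h2 : (m * b + j) / b = m := by
        rw [mul_comm, Nat.mul_add_div (by omega), Nat.div_eq_of_lt hj, add_zero]
      rw [h2]
      simp [blockWeight, Nat.add_mod]
    rw [Finset.sum_congr rfl h1, ← Finset.mul_sum]
    obtain ⟨c, rfl⟩ : ∃ c, b = c + 1 := ⟨b - 1, by omega⟩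
    rw [Finset.sum_range_succ']
    have h3 : ∀ j ∈ Finset.range c, blockWeight (c + 1) (j + 1) = 1 := by
      intro j hj
      rw [Finset.mem_range] at hj
      rw [blockWeight, if_neg]
      rw [Nat.mod_eq_of_lt (by omega)]
      omega
    rw [Finset.sum_congr rfl h3]
    simp [blockWeight]

theorem sum_fin_mul_blockWeight {b n : ℕ} (hb : 2 ≤ b) (hn : b ∣ n) (f : ℕ → ℝ) :
    ∑ z : Fin n, f (z / b) * blockWeight b z = 0 := by
  obtain ⟨m, rfl⟩ := hn
  rw [Fin.sum_univ_eq_sum_range (fun z => f (z / b) * blockWeight b z), mul_comm b m]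
  exact sum_mul_blockWeight hb f m

/-- The weights sum to zero on each block, so `E * H * E = 0`, and `H + H * E * H` is then an
inverse of `D - E`. -/
theorem rank_diagonal_sub_of_block_constant {b n : ℕ} (hb : 2 ≤ b) (hn : b ∣ n)
    (F : ℕ → ℕ → ℝ) :
    (Matrix.diagonal (fun x : Fin n => (blockWeight b x)⁻¹) -
      Matrix.of fun x y : Fin n => F (x / b) (y / b)).rank = n := by
  set E : Matrix (Fin n) (Fin n) ℝ := Matrix.of fun x y => F (x / b) (y / b) with hE
  set H : Matrix (Fin n) (Fin n) ℝ := Matrix.diagonal fun x => blockWeight b x with hH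
  set D : Matrix (Fin n) (Fin n) ℝ := Matrix.diagonal fun x => (blockWeight b x)⁻¹ with hD
  have hDH : D * H = 1 := by
    rw [hD, hH, Matrix.diagonal_mul_diagonal, ← Matrix.diagonal_one]
    congr 1
    ext x
    exact inv_mul_cancel₀ (blockWeight_ne_zero hb _)
  have hEHE : E * H * E = 0 := by
    ext x y
    rw [Matrix.mul_apply]
    simp only [hH, Matrix.mul_diagonal, hE, Matrix.of_apply, Matrix.zero_apply]
    rw [← sum_fin_mul_blockWeight hb hn (fun c => F (x / b) c * F c (y / b))]
    exact Finset.sum_congr rfl fun z _ => by ring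
  have h1 : (D - E) * (H + H * E * H) = 1 := by
    have : (D - E) * (H + H * E * H) =
      D * H + (D * H) * E * H - E * H - (E * H * E) * H := by noncomm_ring
    rw [this, hDH, hEHE]
    simp
  have h2 := Matrix.rank_of_isUnit (D - E)
    (IsUnit.of_mul_eq_one _ h1)
  simpa using h2

/-- The left factors of the rank-one terms in the decomposition of the inverse weight matrix. -/
noncomputable def leftFactor (b n : ℕ) (e₀ i : Fin n) : Fin n → ℝ :=
  Pi.single i 1 - (blockWeight b i / blockWeight b e₀) • Pi.single e₀ 1

/-- The right factors of the rank-one terms in the decomposition of the inverse weight matrix. -/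
noncomputable def rightFactor (b n : ℕ) (e₁ i : Fin n) : Fin n → ℝ :=
  Pi.single i (blockWeight b i)⁻¹ - Pi.single e₁ 1

/-- Over all `i` the products sum to the diagonal minus the two tangent terms, because the weights
total zero. The terms at `e₀` (left factor) and `e₁` (right factor, weight 1) vanish, which leaves n
- 2 of them. -/
theorem diagonal_eq_tangent_add_sum {b n : ℕ} (hb : 2 ≤ b) (hn : b ∣ n)
    {e₀ e₁ : Fin n} (h₀ : e₀.val = 0) (h₁ : e₁.val = 1) :
    Matrix.diagonal (fun x : Fin n => (blockWeight b x)⁻¹) =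
      Matrix.vecMulVec 1 (Pi.single e₁ 1) +
      Matrix.vecMulVec (Pi.single e₀ (blockWeight b e₀)⁻¹) 1 +
      ∑ i ∈ (Finset.univ.erase e₀).erase e₁,
        Matrix.vecMulVec (leftFactor b n e₀ i) (rightFactor b n e₁ i) := by
  have hne : e₁ ≠ e₀ := by
    intro h
    rw [h] at h₁
    omega
  have hw₁ : blockWeight b e₁ = 1 := by
    rw [blockWeight, if_neg]
    rw [h₁, Nat.mod_eq_of_lt (by omega)]
    omega
  have hw₀ : blockWeight b e₀ ≠ 0 := blockWeight_ne_zero hb _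
  have hsum : ∑ i : Fin n, blockWeight b i = 0 := by
    simpa using sum_fin_mul_blockWeight hb hn (fun _ => 1)
  rw [Finset.sum_erase_eq_sub (Finset.mem_erase.2 ⟨hne, Finset.mem_univ _⟩),
    Finset.sum_erase_eq_sub (Finset.mem_univ _)]
  ext x y
  simp only [Matrix.add_apply, Matrix.sub_apply, Matrix.sum_apply, Matrix.vecMulVec_apply,
    leftFactor, rightFactor, Pi.sub_apply, Pi.smul_apply, Pi.one_apply, smul_eq_mul]
  have key : ∑ i : Fin n, ((Pi.single i (1 : ℝ) : Fin n → ℝ) x -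
      blockWeight b i / blockWeight b e₀ * (Pi.single e₀ (1 : ℝ) : Fin n → ℝ) x) *
      ((Pi.single i (blockWeight b i)⁻¹ : Fin n → ℝ) y - (Pi.single e₁ (1 : ℝ) : Fin n → ℝ) y) =
      (if x = y then (blockWeight b x)⁻¹ else 0)
        - (Pi.single e₁ (1 : ℝ) : Fin n → ℝ) y
        - (Pi.single e₀ (1 : ℝ) : Fin n → ℝ) x / blockWeight b e₀ := by
    have e : ∀ i : Fin n, ((Pi.single i (1 : ℝ) : Fin n → ℝ) x -
      blockWeight b i / blockWeight b e₀ * (Pi.single e₀ (1 : ℝ) : Fin n → ℝ) x) *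
      ((Pi.single i (blockWeight b i)⁻¹ : Fin n → ℝ) y - (Pi.single e₁ (1 : ℝ) : Fin n → ℝ) y) =
      (if x = i then (if y = i then (blockWeight b i)⁻¹ else 0) else 0)
      - (if x = i then (Pi.single e₁ (1 : ℝ) : Fin n → ℝ) y else 0)
      - (if y = i then (Pi.single e₀ (1 : ℝ) : Fin n → ℝ) x / blockWeight b e₀ else 0)
      + blockWeight b i * ((Pi.single e₀ (1 : ℝ) : Fin n → ℝ) x *
          (Pi.single e₁ (1 : ℝ) : Fin n → ℝ) y / blockWeight b e₀) := by
      intro i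
      have := blockWeight_ne_zero hb i
      simp only [Pi.single_apply]
      split_ifs <;> field_simp <;> ring
    rw [Finset.sum_congr rfl fun i _ => e i, Finset.sum_add_distrib, Finset.sum_sub_distrib,
      Finset.sum_sub_distrib, ← Finset.sum_mul, hsum]
    simp [eq_comm]
  rw [key, Matrix.diagonal_apply, hw₁]
  simp only [Pi.single_apply]
  split_ifs <;> simp_all

theorem exists_tangent_matrix {b n s : ℕ} (hb : 2 ≤ b) (hn : b ∣ n) (hs : 1 ≤ s) (hsn : s < n) :
    ∃ (u v : Fin n → ℝ) (N : Matrix (Fin n) (Fin n) ℝ), N.rank + 1 ≤ s ∧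
      ∀ F : ℕ → ℕ → ℝ, s < (Matrix.vecMulVec 1 v + Matrix.vecMulVec u 1 + N -
        Matrix.of fun x y : Fin n => F (x / b) (y / b)).rank := by
  let e₀ : Fin n := ⟨0, by omega⟩
  let e₁ : Fin n := ⟨1, by omega⟩
  have hne : e₁ ≠ e₀ := by simp [e₀, e₁]
  have hcard : ((Finset.univ.erase e₀).erase e₁).card = n - 2 := by
    rw [Finset.card_erase_of_mem (Finset.mem_erase.2 ⟨hne, Finset.mem_univ _⟩),
      Finset.card_erase_of_mem (Finset.mem_univ _), Finset.card_univ, Fintype.card_fin]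
    omega
  obtain ⟨I, hI, hIc⟩ := Finset.exists_subset_card_eq
    (s := (Finset.univ.erase e₀).erase e₁) (n := s - 1) (by omega)
  have hD := diagonal_eq_tangent_add_sum hb hn (e₀ := e₀) (e₁ := e₁) rfl rfl
  rw [← Finset.sum_sdiff hI] at hD
  -- The n - 1 - s discarded terms lower the full rank n by at most that much, so rank at least s +
  -- 1 remains.
  have hR := Matrix.rank_sum_vecMulVec_le (((Finset.univ.erase e₀).erase e₁) \ I)
    (leftFactor b n e₀) (rightFactor b n e₁)
  rw [Finset.card_sdiff_of_subset hI, hcard, hIc] at hR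
  have hN := Matrix.rank_sum_vecMulVec_le I (leftFactor b n e₀) (rightFactor b n e₁)
  refine ⟨Pi.single e₀ (blockWeight b e₀)⁻¹, Pi.single e₁ 1,
    ∑ i ∈ I, Matrix.vecMulVec (leftFactor b n e₀ i) (rightFactor b n e₁ i),
    by omega, fun F => ?_⟩
  have h1 := rank_diagonal_sub_of_block_constant hb hn F
  rw [hD] at h1
  generalize (∑ i ∈ ((Finset.univ.erase e₀).erase e₁) \ I,
    Matrix.vecMulVec (leftFactor b n e₀ i) (rightFactor b n e₁ i)) = R at *
  have h2 : ∀ A B E N : Matrix (Fin n) (Fin n) ℝ,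
      A + B + (R + N) - E = (A + B + N - E) + R := by
    intros; abel
  rw [h2] at h1
  have h3 := Matrix.rank_add_le_add (m := Fin n) (n := Fin n) _ R |>.trans' h1.ge
  omega

theorem rank_tangent_approx_le {n s : ℕ} (u v : Fin n → ℝ) (N : Matrix (Fin n) (Fin n) ℝ)
    (hN : N.rank + 1 ≤ s) (t : ℝ) :
    (Matrix.vecMulVec (t • 1 + u) (1 + t⁻¹ • v) + N).rank ≤ s := by
  have h1 := Matrix.rank_add_le_add (Matrix.vecMulVec (t • 1 + u) (1 + t⁻¹ • v)) N
  have h2 := Matrix.rank_vecMulVec_le (t • 1 + u) (1 + t⁻¹ • v)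
  omega

/-! ### Tensor trains and matrix rank -/

/-- The index with first coordinate `x` and all other coordinates `y`. -/
def pairIndex {α : Type*} (d : ℕ) (x y : α) : Fin d → α := fun j => if j.val = 0 then x else y

theorem ttBond_one {d : ℕ} (hd : 2 ≤ d) (r : Fin (d - 1) → ℕ) (j : Fin (d + 1)) (hj : j.val = 1) :
    ttBond r j = r ⟨0, by omega⟩ := by
  unfold ttBond
  rw [dif_pos (by omega)]
  congr 2
  omega

theorem ttBond_pos {d : ℕ} (hd : 2 ≤ d) {r : Fin (d - 1) → ℕ}
    (hr : ∀ j, j ≠ ⟨0, by omega⟩ → 0 < r j) (j : Fin (d + 1)) (hj : j.val ≠ 1) :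
    0 < ttBond r j := by
  unfold ttBond
  split_ifs with h
  · refine hr _ fun h' => hj ?_
    have := congrArg Fin.val h'
    simp only at this
    omega
  · exact one_pos

/-- Cutting the train after its first core factors the slice through the first bond. -/
theorem rank_of_mem_TT {d n : ℕ} (hd : 2 ≤ d) {r : Fin (d - 1) → ℕ} {T : Tensor d n}
    (hT : T ∈ TT d n r) :
    (Matrix.of fun x y => T (pairIndex d x y)).rank ≤ r ⟨0, by omega⟩ := by
  obtain ⟨G, hG⟩ := hT
  obtain ⟨e, rfl⟩ : ∃ e, d = e + 2 := ⟨d - 2, by omega⟩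
  have h1 := ttBond_one hd r (Fin.succ 0) rfl
  have h0 : ttBond r (Fin.castSucc 0) = 1 := by simp [ttBond]
  let z : Fin (ttBond r (Fin.castSucc 0)) := ⟨0, by omega⟩
  have hz : ∀ a : Fin (ttBond r (Fin.castSucc 0)), a = z := by
    intro a
    apply Fin.ext
    have := a.isLt
    simp only [z]
    omega
  let g : Matrix (Fin n) (Fin (ttBond r (Fin.succ 0))) ℝ := Matrix.of fun x a => G 0 x z a
  let h : Matrix (Fin (ttBond r (Fin.succ 0))) (Fin n) ℝ := Matrix.of fun a y =>
    ∑ α : ((j : Fin (e + 2 + 1)) → Fin (ttBond r j)) with α (Fin.succ 0) = a,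
      ∏ j : Fin (e + 1), G j.succ y (α j.succ.castSucc) (α j.succ.succ)
  have hgh : (Matrix.of fun x y => T (pairIndex (e + 2) x y)) = g * h := by
    ext x y
    simp only [Matrix.of_apply, Matrix.mul_apply, g, h]
    rw [hG, ← Finset.sum_fiberwise Finset.univ
      (fun α : ((j : Fin (e + 2 + 1)) → Fin (ttBond r j)) => α (Fin.succ 0))]
    refine Finset.sum_congr rfl fun a _ => ?_
    rw [Finset.mul_sum]
    refine Finset.sum_congr rfl fun α hα => ?_
    rw [Finset.mem_filter] at hα
    rw [Fin.prod_univ_succ, hz (α (Fin.castSucc 0)), hα.2]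
    rfl
  rw [hgh, ← h1]
  exact (Matrix.rank_mul_le_left _ _).trans ((Matrix.rank_le_card_width g).trans_eq (Fintype.card_fin _))

/-- A rank factorization of `M` gives the first two cores; later cores pass on channel 0, which
exists because the other ranks are positive. -/
theorem mem_TT_of_rank_le {d n : ℕ} (hd : 2 ≤ d) {r : Fin (d - 1) → ℕ}
    (hr : ∀ j, j ≠ ⟨0, by omega⟩ → 0 < r j) {M : Matrix (Fin n) (Fin n) ℝ}
    (hM : M.rank ≤ r ⟨0, by omega⟩) :
    (fun i => M (i ⟨0, by omega⟩) (i ⟨1, by omega⟩)) ∈ TT d n r := by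
  obtain ⟨g, h, rfl⟩ := Matrix.rank_le_iff_exists_mul.1 hM
  obtain ⟨e, rfl⟩ : ∃ e, d = e + 2 := ⟨d - 2, by omega⟩
  have h1 : ∀ j : Fin (e + 2 + 1), j.val = 1 → ttBond r j = r ⟨0, by omega⟩ := ttBond_one hd r
  refine ⟨fun j x a c =>
    if h0 : j.val = 0 then g x ⟨c, c.isLt.trans_eq (h1 _ (by simp [h0]))⟩
    else if h2 : j.val = 1 then
      if c.val = 0 then h ⟨a, a.isLt.trans_eq (h1 _ (by simp [h2]))⟩ x else 0
    else if c.val = 0 then 1 else 0, fun i => ?_⟩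
  -- The only bond paths with a nonzero product: `a` at bond 1 and 0 elsewhere.
  let E : Fin (r ⟨0, by omega⟩) → (j : Fin (e + 2 + 1)) → Fin (ttBond r j) := fun a j =>
    if hj : j.val = 1 then ⟨a, a.isLt.trans_eq (h1 j hj).symm⟩
    else ⟨0, ttBond_pos hd hr j hj⟩
  have hE1 : ∀ a (j : Fin (e + 2 + 1)), j.val = 1 → (E a j).val = a := by
    intro a j hj; simp [E, hj]
  have hE0 : ∀ a (j : Fin (e + 2 + 1)), j.val ≠ 1 → (E a j).val = 0 := by
    intro a j hj; simp [E, hj]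
  have hEinj : Function.Injective E := by
    intro a a' haa
    have := congrArg Fin.val (congrFun haa (Fin.succ 0))
    rw [hE1 _ _ (by simp), hE1 _ _ (by simp)] at this
    exact Fin.ext this
  refine Matrix.mul_apply.trans ?_
  refine Fintype.sum_of_injective E hEinj _ _ ?_ ?_
  · intro α hα
    by_contra hne
    apply hα
    have hf := Finset.prod_ne_zero_iff.1 hne
    refine ⟨⟨α (Fin.succ 0), (α (Fin.succ 0)).isLt.trans_eq (h1 _ (by simp))⟩, ?_⟩
    funext j
    apply Fin.ext
    by_cases hj : j.val = 1
    · obtain rfl : j = Fin.succ 0 := Fin.ext (by simpa using hj)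
      rw [hE1 _ _ (by simp)]
    · rw [hE0 _ _ hj]
      rcases Fin.eq_zero_or_eq_succ j with rfl | ⟨l, rfl⟩
      · have := (α 0).isLt
        have h0 : ttBond r (0 : Fin (e + 2 + 1)) = 1 := by simp [ttBond]
        omega
      · have hl : l.val ≠ 0 := by
          intro h; apply hj; simp [h]
        have := hf l (Finset.mem_univ _)
        simp only [hl, dite_false] at this
        by_contra h'
        apply this
        by_cases h2 : l.val = 1
        · rw [dif_pos h2]
          exact if_neg fun h0 => h' h0.symm
        · rw [dif_neg h2]
          exact if_neg fun h0 => h' h0.symm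
  · intro a
    rw [Fin.prod_univ_succ, Fin.prod_univ_succ, Finset.prod_eq_one]
    · have e1 := hE1 a (Fin.succ 0) (by simp)
      have e1' := hE1 a (Fin.castSucc (Fin.succ 0)) (by simp)
      have e2 := hE0 a (Fin.succ (Fin.succ 0)) (by simp only [Fin.val_succ]; omega)
      simp only [e1, e1', e2]
      simp
      rfl
    · intro j _
      have e2 := hE0 a (Fin.succ (Fin.succ (Fin.succ j))) (by simp)
      simp only [e2]
      simp

theorem zero_mem_TT {d n : ℕ} (hd : 2 ≤ d) (r : Fin (d - 1) → ℕ) : 0 ∈ TT d n r := by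
  refine ⟨fun _ _ => 0, fun i => ?_⟩
  symm
  refine Finset.sum_eq_zero fun α _ => ?_
  exact Finset.prod_eq_zero (Finset.mem_univ ⟨0, by omega⟩) rfl

theorem eq_zero_of_mem_TT_zero {d n : ℕ} (hd : 2 ≤ d) {T : Tensor d n} (hT : T ∈ TT d n 0) :
    T = 0 := by
  obtain ⟨G, hG⟩ := hT
  funext i
  rw [hG i]
  refine Finset.sum_eq_zero fun α _ => ?_
  have := (α ⟨1, by omega⟩).isLt.trans_eq (ttBond_one hd 0 ⟨1, by omega⟩ rfl)
  exact absurd this (by simp)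

theorem mem_TT_two_iff {n : ℕ} {r : Fin (2 - 1) → ℕ} {T : Tensor 2 n} :
    T ∈ TT 2 n r ↔ (Matrix.of fun x y => T (pairIndex 2 x y)).rank ≤ r 0 := by
  refine ⟨fun h => rank_of_mem_TT le_rfl h, fun h => ?_⟩
  have := mem_TT_of_rank_le (d := 2) le_rfl (r := r)
    (fun j hj => absurd (Subsingleton.elim (α := Fin 1) j _) hj) h
  convert this using 1
  funext i
  simp only [Matrix.of_apply]
  congr 1
  funext j
  fin_cases j <;> rfl

theorem isClosed_TT_two (n : ℕ) (r : Fin (2 - 1) → ℕ) : IsClosed (TT 2 n r) := by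
  have h : Continuous fun T : Tensor 2 n => Matrix.of fun x y => T (pairIndex 2 x y) := by
    refine continuous_pi fun x => continuous_pi fun y => ?_
    exact continuous_apply (pairIndex 2 x y)
  convert (Matrix.isClosed_setOf_rank_le (m := Fin n) (n := Fin n) (r 0)).preimage h using 1
  ext T
  exact mem_TT_two_iff

theorem TT_two_eq_univ {n : ℕ} {r : Fin (2 - 1) → ℕ} (h : n ≤ r 0) : TT 2 n r = Set.univ := by
  refine Set.eq_univ_of_forall fun T => mem_TT_two_iff.2 ?_
  exact (by simpa using Matrix.rank_le_card_width (Matrix.of fun x y => T (pairIndex 2 x y)) :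
    _ ≤ n).trans h

/-! ### Block extensions and their sums -/

/-- Evaluation at block corners pulls everything back to level `k`. The remainder mod `b ^ j`
changes nothing; it only supplies the index bound. -/
theorem blockExt_apply_scaled {d b k j m : ℕ} (hb : 0 < b) (hjk : j ≤ k) (hkm : k ≤ m)
    (T : Tensor d (b ^ j)) (i : Fin d → ℕ) (hi : ∀ l, i l * b ^ (m - k) < b ^ m) :
    blockExt (hjk.trans hkm) T (fun l => ⟨i l * b ^ (m - k), hi l⟩) =
      T fun l => ⟨i l / b ^ (k - j) % b ^ j, Nat.mod_lt _ (pow_pos hb _)⟩ := by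
  unfold blockExt
  congr 1
  funext l
  apply Fin.ext
  have h1 : i l * b ^ (m - k) / b ^ (m - j) = i l / b ^ (k - j) := by
    have : m - j = (k - j) + (m - k) := by omega
    rw [this, pow_add]
    exact Nat.mul_div_mul_right _ _ (pow_pos hb _)
  have h2 := coarse_index_lt (hjk.trans hkm) ⟨_, hi l⟩
  simp only [h1] at h2 ⊢
  exact (Nat.mod_eq_of_lt h2).symm

theorem mul_pow_sub_lt {b k m x : ℕ} (hb : 0 < b) (hkm : k ≤ m) (hx : x < b ^ k) :
    x * b ^ (m - k) < b ^ m := by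
  calc x * b ^ (m - k) < b ^ k * b ^ (m - k) := Nat.mul_lt_mul_of_pos_right hx (pow_pos hb _)
    _ = b ^ m := by rw [← pow_add, Nat.add_sub_cancel' hkm]

theorem blockExt_zero {d b k m : ℕ} (h : k ≤ m) :
    blockExt h (0 : Tensor d (b ^ k)) = 0 := rfl

theorem blockExt_blockExt {d b j k m : ℕ} (hjk : j ≤ k) (hkm : k ≤ m) (T : Tensor d (b ^ j)) :
    blockExt hkm (blockExt hjk T) = blockExt (hjk.trans hkm) T := by
  funext i
  unfold blockExt
  congr 1
  funext l
  apply Fin.ext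
  have : m - j = (m - k) + (k - j) := by omega
  simp only [this, pow_add, Nat.div_div_eq_div_mul]

theorem continuous_blockExt {d b k m : ℕ} (h : k ≤ m) :
    Continuous (blockExt h : Tensor d (b ^ k) → Tensor d (b ^ m)) :=
  continuous_pi fun _ => continuous_apply _

/-- Sampling at block corners is a continuous left inverse. -/
theorem isClosedEmbedding_blockExt {d b k m : ℕ} (hb : 0 < b) (h : k ≤ m) :
    Topology.IsClosedEmbedding (blockExt h : Tensor d (b ^ k) → Tensor d (b ^ m)) := by
  let res : Tensor d (b ^ m) → Tensor d (b ^ k) := fun T i =>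
    T fun l => ⟨(i l).val * b ^ (m - k), mul_pow_sub_lt hb h (i l).isLt⟩
  refine Function.LeftInverse.isClosedEmbedding (f := res) ?_ ?_ (continuous_blockExt h)
  · intro T
    funext i
    refine (blockExt_apply_scaled hb le_rfl h T (fun l => (i l).val) _).trans ?_
    congr 1
    funext l
    apply Fin.ext
    simp [Nat.mod_eq_of_lt (i l).isLt]
  · exact continuous_pi fun _ => continuous_apply _

theorem sum_blockExt_single {b L d : ℕ} (k : Fin (L + 1)) (Y : Tensor d (b ^ k.val)) :
    ∑ j : Fin (L + 1), blockExt j.is_le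
      ((Pi.single k Y : (j : Fin (L + 1)) → Tensor d (b ^ j.val)) j) = blockExt k.is_le Y := by
  rw [Finset.sum_eq_single k]
  · rw [Pi.single_eq_same]
  · intro j _ hj
    rw [Pi.single_eq_of_ne hj, blockExt_zero]
  · simp

theorem blockExt_mem_MSTT {b L d : ℕ} (hd : 2 ≤ d) {r : Fin (L + 1) → Fin (d - 1) → ℕ}
    (k : Fin (L + 1)) {Y : Tensor d (b ^ k.val)} (hY : Y ∈ TT d (b ^ k.val) (r k)) :
    blockExt k.is_le Y ∈ MSTT b L d r := by
  refine ⟨Pi.single k Y, fun j => ?_, (sum_blockExt_single k Y).symm⟩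
  by_cases hj : j = k
  · subst hj
    rwa [Pi.single_eq_same]
  · rw [Pi.single_eq_of_ne hj]
    exact zero_mem_TT hd _

theorem blockExt_add_blockExt_mem_MSTT {b L d : ℕ} (hd : 2 ≤ d)
    {r : Fin (L + 1) → Fin (d - 1) → ℕ} {i k : Fin (L + 1)} (hik : i ≠ k)
    {Y : Tensor d (b ^ k.val)} (hY : Y ∈ TT d (b ^ k.val) (r k))
    {Z : Tensor d (b ^ i.val)} (hZ : Z ∈ TT d (b ^ i.val) (r i)) :
    blockExt k.is_le Y + blockExt i.is_le Z ∈ MSTT b L d r := by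
  refine ⟨Pi.single k Y + Pi.single i Z, fun j => ?_, ?_⟩
  · by_cases hj : j = k
    · subst hj
      rwa [Pi.add_apply, Pi.single_eq_same, Pi.single_eq_of_ne hik.symm, add_zero]
    · rw [Pi.add_apply, Pi.single_eq_of_ne hj, zero_add]
      by_cases hj' : j = i
      · subst hj'
        rwa [Pi.single_eq_same]
      · rw [Pi.single_eq_of_ne hj']
        exact zero_mem_TT hd _
  · rw [← sum_blockExt_single k Y, ← sum_blockExt_single i Z, ← Finset.sum_add_distrib]
    rfl

/-! ### Closedness and non-closedness of the format -/

theorem exists_rank_sub_block_constant_le {b L d : ℕ} (hb : 2 ≤ b) (hd : 2 ≤ d)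
    {r : Fin (L + 1) → Fin (d - 1) → ℕ} {k : Fin (L + 1)} (hr : ∀ i, k < i → r i = 0)
    {X : Tensor d (b ^ k.val)} (hX : blockExt k.is_le X ∈ MSTT b L d r) :
    ∃ F : ℕ → ℕ → ℝ, ((Matrix.of fun x y => X (pairIndex d x y)) -
      Matrix.of fun x y : Fin (b ^ k.val) => F (x / b) (y / b)).rank ≤ r k ⟨0, by omega⟩ := by
  obtain ⟨S, hS, hXS⟩ := hX
  have hb0 : 0 < b := by omega
  let idx : Fin (b ^ k.val) → Fin (b ^ k.val) → Fin d → Fin (b ^ L) := fun x y l =>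
    ⟨(pairIndex d x y l).val * b ^ (L - k.val), mul_pow_sub_lt hb0 k.is_le (Fin.isLt _)⟩
  have hk : ∀ (Y : Tensor d (b ^ k.val)) x y,
      blockExt k.is_le Y (idx x y) = Y (pairIndex d x y) := by
    intro Y x y
    refine (blockExt_apply_scaled hb0 le_rfl k.is_le Y (fun l => (pairIndex d x y l).val) _).trans ?_
    congr 1
    funext l
    apply Fin.ext
    simp [Nat.mod_eq_of_lt (pairIndex d x y l).isLt]
  have hF : ∀ j : Fin (L + 1), ∃ F : ℕ → ℕ → ℝ, j ≠ k → ∀ x y,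
      blockExt j.is_le (S j) (idx x y) = F (x.val / b) (y.val / b) := by
    intro j
    rcases lt_trichotomy j k with hj | hj | hj
    · refine ⟨fun c c' => S j fun l =>
        ⟨pairIndex d c c' l / b ^ (k.val - j.val - 1) % b ^ j.val, Nat.mod_lt _ (pow_pos hb0 _)⟩,
        fun _ x y => ?_⟩
      refine (blockExt_apply_scaled hb0 (Fin.le_def.1 hj.le) k.is_le (S j)
        (fun l => (pairIndex d x y l).val) _).trans ?_
      congr 1
      funext l
      apply Fin.ext
      -- As `j < k`, at least one factor `b` splits off, so level `j` sees only `x / b` and `y / b`.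
      have hpow : b ^ (k.val - j.val) = b * b ^ (k.val - j.val - 1) := by
        rw [← pow_succ']
        congr 1
        have := Fin.lt_def.1 hj
        omega
      simp only [hpow, ← Nat.div_div_eq_div_mul, pairIndex]
      split_ifs <;> rfl
    · exact ⟨0, fun h => absurd hj h⟩
    · refine ⟨0, fun _ x y => ?_⟩
      have h0 := hS j
      rw [hr j hj] at h0
      rw [eq_zero_of_mem_TT_zero hd h0]
      rfl
  choose F hF using hF
  refine ⟨fun c c' => ∑ j ∈ Finset.univ.erase k, F j c c', ?_⟩
  refine le_trans (le_of_eq ?_) (rank_of_mem_TT hd (hS k))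
  congr 1
  ext x y
  have h1 := congrFun hXS (idx x y)
  rw [hk, Finset.sum_apply, ← Finset.add_sum_erase _ _ (Finset.mem_univ k), hk,
    Finset.sum_congr rfl fun j hj => hF j (Finset.ne_of_mem_erase hj) x y] at h1
  simp only [Matrix.sub_apply, Matrix.of_apply, h1]
  ring

theorem not_isClosed_MSTT {b L d : ℕ} (hb : 2 ≤ b) (hd : 2 ≤ d)
    {r : Fin (L + 1) → Fin (d - 1) → ℕ} {i k : Fin (L + 1)} (hik : i < k)
    (hri : ∀ j, 0 < r i j) (hrk : ∀ j, 0 < r k j) (hr : ∀ j, k < j → r j = 0)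
    (hlt : r k ⟨0, by omega⟩ < b ^ k.val) : ¬ IsClosed (MSTT b L d r) := by
  intro hcl
  have hdvd : b ∣ b ^ k.val := dvd_pow_self b (by have := Fin.lt_def.1 hik; omega)
  obtain ⟨u, v, N, hN, hrank⟩ := exists_tangent_matrix hb hdvd (hrk ⟨0, by omega⟩) hlt
  let lift : (m : ℕ) → Matrix (Fin m) (Fin m) ℝ → Tensor d m := fun m M i =>
    M (i ⟨0, by omega⟩) (i ⟨1, by omega⟩)
  let X : Tensor d (b ^ k.val) :=
    lift (b ^ k.val) (Matrix.vecMulVec 1 v + Matrix.vecMulVec u 1 + N)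
  let W : Tensor d (b ^ k.val) := lift (b ^ k.val) (Matrix.vecMulVec u v)
  have hmem : ∀ t : ℝ, t ≠ 0 → blockExt k.is_le (X + t⁻¹ • W) ∈ MSTT b L d r := by
    intro t ht
    have hY : lift (b ^ k.val) (Matrix.vecMulVec (t • 1 + u) (1 + t⁻¹ • v) + N)
        ∈ TT d (b ^ k.val) (r k) :=
      mem_TT_of_rank_le hd (fun j _ => hrk j) (rank_tangent_approx_le u v N hN t)
    have hZ : lift (b ^ i.val) (Matrix.vecMulVec ((-t) • 1) 1) ∈ TT d (b ^ i.val) (r i) :=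
      mem_TT_of_rank_le hd (fun j _ => hri j) ((Matrix.rank_vecMulVec_le _ _).trans (hri _))
    -- The t11ᵀ terms of the two levels cancel.
    convert blockExt_add_blockExt_mem_MSTT hd hik.ne hY hZ using 1
    funext l
    simp only [blockExt, lift, X, W, Pi.add_apply, Pi.smul_apply, Matrix.add_apply,
      Matrix.vecMulVec_apply, smul_eq_mul, Pi.one_apply]
    field_simp
    ring
  have hlim : Filter.Tendsto (fun m : ℕ => blockExt k.is_le (X + ((m : ℝ) + 1)⁻¹ • W))
      Filter.atTop (nhds (blockExt k.is_le X)) := by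
    have h1 : Filter.Tendsto (fun m : ℕ => X + ((m : ℝ) + 1)⁻¹ • W) Filter.atTop
        (nhds (X + (0 : ℝ) • W)) := by
      refine tendsto_const_nhds.add (Filter.Tendsto.smul_const ?_ W)
      simpa using tendsto_one_div_add_atTop_nhds_zero_nat (𝕜 := ℝ)
    rw [zero_smul, add_zero] at h1
    exact ((continuous_blockExt k.is_le).tendsto X).comp h1
  have hX : blockExt k.is_le X ∈ MSTT b L d r :=
    hcl.mem_of_tendsto hlim (Filter.Eventually.of_forall fun m => hmem _ (by positivity))
  obtain ⟨F, hF⟩ := exists_rank_sub_block_constant_le hb hd hr hX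
  refine (hrank F).not_ge (le_trans (le_of_eq ?_) hF)
  congr 2

/-- A full level `k` absorbs all coarser levels. -/
theorem isClosed_MSTT_two_of_full {b L : ℕ} (hb : 2 ≤ b) {r : Fin (L + 1) → Fin (2 - 1) → ℕ}
    {k : Fin (L + 1)} (hk : b ^ k.val ≤ r k 0) (hr : ∀ i, k < i → r i = 0) :
    IsClosed (MSTT b L 2 r) := by
  have : MSTT b L 2 r = Set.range (blockExt k.is_le) := by
    ext T
    constructor
    · rintro ⟨S, hS, rfl⟩
      have hj : ∀ j : Fin (L + 1), ∃ Y : Tensor 2 (b ^ k.val),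
          blockExt j.is_le (S j) = blockExt k.is_le Y := by
        intro j
        rcases le_or_gt j k with hj | hj
        · exact ⟨blockExt (Fin.le_def.1 hj) (S j), (blockExt_blockExt _ _ _).symm⟩
        · have h0 := hS j
          rw [hr j hj] at h0
          exact ⟨0, by rw [eq_zero_of_mem_TT_zero le_rfl h0]; rfl⟩
      choose Y hY using hj
      refine ⟨∑ j, Y j, ?_⟩
      funext l
      simp only [hY, Finset.sum_apply, blockExt]
    · rintro ⟨Y, rfl⟩
      refine blockExt_mem_MSTT le_rfl k ?_
      rw [TT_two_eq_univ hk]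
      trivial
  rw [this]
  exact (isClosedEmbedding_blockExt (by omega) k.is_le).isClosed_range

theorem isClosed_MSTT_two_of_single {b L : ℕ} (hb : 2 ≤ b) {r : Fin (L + 1) → Fin (2 - 1) → ℕ}
    {k : Fin (L + 1)} (hr : ∀ i, i ≠ k → r i = 0) : IsClosed (MSTT b L 2 r) := by
  have : MSTT b L 2 r = blockExt k.is_le '' TT 2 (b ^ k.val) (r k) := by
    ext T
    constructor
    · rintro ⟨S, hS, rfl⟩
      refine ⟨S k, hS k, ?_⟩
      rw [Finset.sum_eq_single k]
      · intro j _ hj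
        have h0 := hS j
        rw [hr j hj] at h0
        rw [eq_zero_of_mem_TT_zero le_rfl h0, blockExt_zero]
      · simp
    · rintro ⟨Y, hY, rfl⟩
      exact blockExt_mem_MSTT le_rfl k hY
  rw [this]
  exact (isClosedEmbedding_blockExt (by omega) k.is_le).isClosedMap _ (isClosed_TT_two _ _)

theorem mainTheorem2 (b : ℕ) (hb : 2 ≤ b) (L : ℕ) :
    (∀ r : Fin (L + 1) → Fin (2 - 1) → ℕ,
      IsClosed (MSTT b L 2 r) ↔
        (∃ k : Fin (L + 1), b ^ k.val ≤ r k 0 ∧ ∀ i, k < i → r i = 0) ∨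
        (∃ k : Fin (L + 1), ∀ i, i ≠ k → r i = 0)) ∧
    (∀ (d : ℕ) (hd : 3 ≤ d) (r : Fin (L + 1) → Fin (d - 1) → ℕ),
      (∀ i, r i = 0 ∨ ∀ j, 0 < r i j) →
      ∀ k : Fin (L + 1),
        r k ≠ 0 →
        (∀ i, k < i → r i = 0) →
        r k ⟨0, by omega⟩ < b ^ k.val →
        (∃ i, i < k ∧ r i ⟨0, by omega⟩ ≠ 0) →
        ¬ IsClosed (MSTT b L d r)) := by
  refine ⟨fun r => ⟨fun hcl => ?_, ?_⟩, ?_⟩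
  · by_contra hcon
    obtain ⟨hfull, hsingle⟩ := not_or.1 hcon
    have hne : ∃ i, r i ≠ 0 := by
      by_contra! h
      exact hsingle ⟨0, fun i _ => h i⟩
    obtain ⟨k, hk, hmax⟩ := (Finset.univ.filter fun i => r i ≠ 0).exists_max_image id
      (hne.imp fun i hi => by simpa using hi)
    simp only [Finset.mem_filter, Finset.mem_univ, true_and, id] at hk hmax
    have htop : ∀ i, k < i → r i = 0 := fun i hi => by
      by_contra h
      exact (hmax i h).not_gt hi
    obtain ⟨i, hik, hi⟩ : ∃ i, i ≠ k ∧ r i ≠ 0 := by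
      by_contra! h
      exact hsingle ⟨k, h⟩
    -- For d = 2 there is only one inner bond.
    have hpos : ∀ i, r i ≠ 0 → ∀ j, 0 < r i j := by
      intro i hi j
      by_contra h
      refine hi (funext fun j' => ?_)
      rw [Subsingleton.elim (α := Fin 1) j' j]
      exact Nat.eq_zero_of_not_pos h
    exact not_isClosed_MSTT hb le_rfl (lt_of_le_of_ne (hmax i hi) hik) (hpos i hi) (hpos k hk)
      htop (not_le.1 fun h => hfull ⟨k, h, htop⟩) hcl
  · rintro (⟨k, hk, hr⟩ | ⟨k, hr⟩)
    · exact isClosed_MSTT_two_of_full hb hk hr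
    · exact isClosed_MSTT_two_of_single hb hr
  · rintro d hd r hr k hk htop hlt ⟨i, hik, hi⟩
    exact not_isClosed_MSTT hb (by omega) hik
      ((hr i).resolve_left fun h => hi (by rw [h]; rfl)) ((hr k).resolve_left hk) htop hlt
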